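/- Let $X$ be a $T_1$ space. In the Choquet game $\mathsf{Ch}(X)$, at each round $i<\omega$ the player Empty chooses a point $x_i\in X$ and an open set $U_i\ni x_i$, with $U_i\subseteq V_{i-1}$ if $i\ge 1$, and then the player Nonempty chooses an open set $V_i$ with $x_i\in V_i\subseteq U_i$; Nonempty wins if $\bigcap_{i<\omega}V_i\neq\varnothing$. A strategy $\mathfrak S$ for Nonempty assigns to every finite sequence $\langle x_j,U_j\rangle_{j\le i}$ of moves of Empty against $\mathfrak S$ a legal response $V_i$. It is winning if Nonempty wins every play following it; it is convergent if, for every play $\langle x_i,U_i,V_i\rangle_{i<\omega}$ following it, $\{V_i : i<\omega\}$ is a neighborhood basis at every point of $\bigcap_i V_i$ (a convergent strategy need not be winning); it is stationary if $\mathfrak S(\langle x_j,U_j\rangle_{j\le i})=\mathfrak S(\langle x_i,U_i\rangle)$ for every partial play $\langle x_j,U_j\rangle_{j\le i}$ of Empty against $\mathfrak S$. A space is metacompact if every open cover of it has a point-finite open refinement, and the weight of a space is the least cardinality of a base of its topology. Theorem. The following are equivalent: (a) there are a complete metric space $Z$ and an open continuous surjection $f\colon Z\to X$ such that $f^{-1}(\{x\})$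 is compact for every $x\in X$; (b) $X$ is metacompact and Nonempty has a strategy in $\mathsf{Ch}(X)$ that is both convergent and winning. Moreover, if these conditions hold, then Nonempty has a strategy in $\mathsf{Ch}(X)$ that is stationary, convergent and winning, and $Z$ and $f$ in (a) can be chosen so that $Z$ has the same weight as $X$. -/

import Mathlib

open Set Topology

universe u v

/-- The weight of a topological space: the least cardinality of a base of its topology. -/
noncomputable def topWeight (X : Type u) [TopologicalSpace X] : Cardinal.{u} :=
  sInf {c | ∃ B : Set (Set X), TopologicalSpace.IsTopologicalBasis B ∧ Cardinal.mk B = c}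

/-- A space is metacompact if every open cover has a point-finite open refinement
(which is again a cover). -/
def IsMetacompact (X : Type u) [TopologicalSpace X] : Prop :=
  ∀ C : Set (Set X), (∀ c ∈ C, IsOpen c) → ⋃₀ C = univ →
    ∃ D : Set (Set X), (∀ d ∈ D, IsOpen d) ∧ ⋃₀ D = univ ∧
      (∀ d ∈ D, ∃ c ∈ C, d ⊆ c) ∧ ∀ x : X, {d | d ∈ D ∧ x ∈ d}.Finite

/-- An open continuous compact surjection: an open continuous map onto `X` all of whose
fibers are compact. -/
structure IsOpenContinuousCompactSurjection {Z : Type v} {X : Type u}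
    [TopologicalSpace Z] [TopologicalSpace X] (f : Z → X) : Prop where
  continuous : Continuous f
  isOpenMap : IsOpenMap f
  surjective : Function.Surjective f
  isCompact_fiber : ∀ x : X, IsCompact (f ⁻¹' {x})

namespace ChoquetGame

variable {X : Type u} [TopologicalSpace X]

/-- A finite sequence of moves `(x₀, U₀), …, (xₙ, Uₙ)` of Empty is a (partial) play of Empty in
the Choquet game against the response function `S` of Nonempty if each `Uᵢ` is an open set
containing `xᵢ` and each `Uᵢ` with `i ≥ 1` is contained in the answer that `S` gave to the
moves before it. -/
def IsPartialPlay (S : List (X × Set X) → Set X) (p : List (X × Set X)) : Prop :=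
  ∀ (i : ℕ) (hi : i < p.length),
    IsOpen p[i].2 ∧ p[i].1 ∈ p[i].2 ∧ (1 ≤ i → p[i].2 ⊆ S (p.take i))

/-- A strategy for Nonempty in the Choquet game on `X`: a function of the finite sequence of
the moves of Empty, in the order in which they are made, that answers every partial play ending
with the move `(x, U)` by a legal move, an open set `V` with `x ∈ V ⊆ U`. -/
structure Strategy (X : Type u) [TopologicalSpace X] where
  /-- The response to a sequence of moves of Empty. -/
  respond : List (X × Set X) → Set X
  isOpen_respond : ∀ (p : List (X × Set X)) (x : X) (U : Set X),
    IsPartialPlay respond (p ++ [(x, U)]) → IsOpen (respond (p ++ [(x, U)]))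
  mem_respond : ∀ (p : List (X × Set X)) (x : X) (U : Set X),
    IsPartialPlay respond (p ++ [(x, U)]) → x ∈ respond (p ++ [(x, U)])
  respond_subset : ∀ (p : List (X × Set X)) (x : X) (U : Set X),
    IsPartialPlay respond (p ++ [(x, U)]) → respond (p ++ [(x, U)]) ⊆ U

/-- `(xₙ, Uₙ, Vₙ)` for `n = 0, 1, 2, …` is an infinite play of the Choquet game in which Nonempty
follows the strategy `S`. -/
structure Strategy.IsPlay (S : Strategy X) (x : ℕ → X) (U V : ℕ → Set X) : Prop where
  isOpen : ∀ n, IsOpen (U n)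
  mem : ∀ n, x n ∈ U n
  subset : ∀ n, U (n + 1) ⊆ V n
  follows : ∀ n, V n = S.respond ((List.range (n + 1)).map fun i => (x i, U i))

/-- Nonempty wins every play that follows `S`. -/
def Strategy.IsWinning (S : Strategy X) : Prop :=
  ∀ (x : ℕ → X) (U V : ℕ → Set X), S.IsPlay x U V → (⋂ n, V n).Nonempty

/-- In every play that follows `S`, the sets `Vₙ` form a neighborhood basis of each point of
their intersection. -/
def Strategy.IsConvergent (S : Strategy X) : Prop :=
  ∀ (x : ℕ → X) (U V : ℕ → Set X), S.IsPlay x U V →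
    ∀ z ∈ ⋂ n, V n, (𝓝 z).HasBasis (fun _ : ℕ => True) V

/-- `S` treats each move as the first move. -/
def Strategy.IsStationary (S : Strategy X) : Prop :=
  ∀ (p : List (X × Set X)) (x : X) (U : Set X),
    IsPartialPlay S.respond (p ++ [(x, U)]) → S.respond (p ++ [(x, U)]) = S.respond [(x, U)]

end ChoquetGame

/-! ### From a complete metric space to a stationary strategy. -/

section ImageOfMetricSpace

variable {Z : Type v} {X : Type u}

/-! From (a) to (b): a compact fiber meets only finitely many members of a locally finite family, so
images under `f` of locally finite open covers of `Z` are point-finite open covers of `X`; this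
gives metacompactness. For the game, fix locally finite covers of `Z` with mesh tending to 0.
Nonempty answers `(x, U)` by refining at once every member whose image contains `U`; there are
finitely many of them unless `U` is a single point (`GradedCover.finite_above`). No memory is
needed: whichever nested chain of members the past has produced, its last term is among those
refined. Along a play the chain shrinks to a point of `Z` by completeness, so Nonempty wins, and
small sets meeting a compact fiber have small images, so the strategy converges.

From (b) to (a): the positions of the strategy form a tree of open sets whose branches shrink to
points (`SieveTree`). Metacompactness extracts point-finite levels, and König's lemma then shows
that open sets are F-sigma. Hence open subspaces are metacompact too, and the levels can be chosen
so that the children of each node cover it (`SieveTree.IsLevel.exists_covering_next`). `Z` is the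
space of branches through these levels and `f` sends a branch to its limit: covering makes `f` open,
point-finiteness makes its fibers compact and bounds the weight.

The stationary strategy in the last claim comes from going from (b) to (a) and back. -/

theorem IsOpenContinuousCompactSurjection.isMetacompact [TopologicalSpace Z] [ParacompactSpace Z]
    [TopologicalSpace X] {f : Z → X} (hf : IsOpenContinuousCompactSurjection f) :
    IsMetacompact X := by
  intro C hC hCu
  obtain ⟨v, hvo, hvu, hvf, hvs⟩ := precise_refinement (fun c : C => f ⁻¹' (c : Set X))
    (fun c => (hC c c.2).preimage hf.continuous) (by
      rw [← preimage_iUnion, ← sUnion_eq_iUnion, hCu, preimage_univ])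
  refine ⟨range fun c => f '' v c, ?_, ?_, ?_, fun x => ?_⟩
  · rintro _ ⟨c, rfl⟩
    exact hf.isOpenMap _ (hvo c)
  · rw [sUnion_range, ← image_iUnion, hvu, image_univ, hf.surjective.range_eq]
  · rintro _ ⟨c, rfl⟩
    exact ⟨c, c.2, image_subset_iff.2 (hvs c)⟩
  · refine ((hvf.finite_nonempty_inter_compact (hf.isCompact_fiber x)).image
      fun c => f '' v c).subset ?_
    rintro _ ⟨⟨c, rfl⟩, z, hz, hzx⟩
    exact ⟨c, ⟨z, hz, hzx⟩, rfl⟩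

/-- A family of open sets in a metric space, graded by `rank`, in which the sets of rank `n + 1` form
a locally finite cover of mesh at most `2⁻ⁿ`. The whole space is the only member of rank `0`. -/
structure GradedCover (Z : Type v) [MetricSpace Z] where
  W : ℕ → Z → Set Z
  isOpen : ∀ n z, IsOpen (W n z)
  iUnion_eq : ∀ n, ⋃ z, W n z = univ
  locallyFinite : ∀ n, LocallyFinite (W n)
  subset_closedBall : ∀ n z, W n z ⊆ Metric.closedBall z ((1 / 2) ^ n)

namespace GradedCover

variable [MetricSpace Z]

theorem nonempty : Nonempty (GradedCover Z) := by
  have h : ∀ n : ℕ, ∃ v : Z → Set Z, (∀ z, IsOpen (v z)) ∧ ⋃ z, v z = univ ∧ LocallyFinite v ∧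
      ∀ z, v z ⊆ Metric.ball z ((1 / 2) ^ n) := fun n =>
    precise_refinement _ (fun z => Metric.isOpen_ball)
      (eq_univ_of_forall fun z => mem_iUnion.2 ⟨z, Metric.mem_ball_self (by positivity)⟩)
  choose W h1 h2 h3 h4 using h
  exact ⟨⟨W, h1, h2, h3, fun n z => (h4 n z).trans Metric.ball_subset_closedBall⟩⟩

variable (c : GradedCover Z)

/-- The members of the family. -/
def sets : Option (ℕ × Z) → Set Z
  | none => univ
  | some (n, z) => c.W n z

/-- The rank of a member of the family. -/
def rank : Option (ℕ × Z) → ℕ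
  | none => 0
  | some (n, _) => n + 1

theorem isOpen_sets : ∀ i, IsOpen (c.sets i)
  | none => isOpen_univ
  | some (n, z) => c.isOpen n z

theorem dist_le {i : Option (ℕ × Z)} {n : ℕ} (hi : n < rank i) {a b : Z} (ha : a ∈ c.sets i)
    (hb : b ∈ c.sets i) : dist a b ≤ 2 * (1 / 2) ^ n := by
  match i with
  | none => exact absurd hi (Nat.not_lt_zero _)
  | some (m, z) =>
    have h1 := Metric.mem_closedBall.1 (c.subset_closedBall m z ha)
    have h2 := Metric.mem_closedBall.1 (c.subset_closedBall m z hb)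
    have h3 : ((1 : ℝ) / 2) ^ m ≤ (1 / 2) ^ n :=
      pow_le_pow_of_le_one (by norm_num) (by norm_num) (Nat.lt_succ_iff.1 hi)
    linarith [dist_triangle_right a b z]

theorem exists_closure_subset {O : Set Z} (hO : IsOpen O) {z : Z} (hz : z ∈ O) (n : ℕ) :
    ∃ i, n < rank i ∧ z ∈ c.sets i ∧ closure (c.sets i) ⊆ O := by
  obtain ⟨ε, hε, hεO⟩ := Metric.nhds_basis_closedBall.mem_iff.1 (hO.mem_nhds hz)
  obtain ⟨m, hm⟩ := exists_pow_lt_of_lt_one (half_pos hε) (show (1 / 2 : ℝ) < 1 by norm_num)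
  have hz' : z ∈ ⋃ w, c.W (max m n) w := c.iUnion_eq _ ▸ mem_univ z
  obtain ⟨w, hw⟩ := mem_iUnion.1 hz'
  refine ⟨some (max m n, w), by simp [rank], hw, ?_⟩
  refine (closure_minimal (fun y hy => ?_) Metric.isClosed_closedBall).trans hεO
  have h1 := c.dist_le (i := some (max m n, w)) (n := m) (by simp [rank]) hy hw
  rw [Metric.mem_closedBall]
  linarith

variable [TopologicalSpace X] {f : Z → X}

/-- The members of the family whose images contain a given set. -/
def above (f : Z → X) (U : Set X) : Set (Option (ℕ × Z)) := {i | U ⊆ f '' c.sets i}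

/-- A compact fiber has a uniform thickening inside the preimage of `O`, and members of large rank
that meet the fiber are too small to leave it. -/
theorem exists_rank_bound (hf : IsOpenContinuousCompactSurjection f) {O : Set X} (hO : IsOpen O)
    {x : X} (hx : x ∈ O) :
    ∃ n, ∀ i, n < rank i → x ∈ f '' c.sets i → f '' c.sets i ⊆ O := by
  obtain ⟨δ, hδ, hδO⟩ := (hf.isCompact_fiber x).exists_thickening_subset_open
    (hO.preimage hf.continuous) (by rintro z rfl; exact hx)
  obtain ⟨n, hn⟩ := exists_pow_lt_of_lt_one (half_pos hδ) (show (1 / 2 : ℝ) < 1 by norm_num)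
  refine ⟨n, ?_⟩
  rintro i hi ⟨z, hz, hzx⟩ _ ⟨y, hy, rfl⟩
  refine hδO (Metric.mem_thickening_iff.2 ⟨z, hzx, ?_⟩)
  linarith [c.dist_le hi hy hz]

/-- A second point `y` of `U` bounds the rank: members of high rank meeting the fiber over `x` have
images that miss `y`. At each lower rank, local finiteness leaves finitely many members meeting that
compact fiber. -/
theorem finite_above [T1Space X] (hf : IsOpenContinuousCompactSurjection f) {U : Set X}
    (hU : U.Nontrivial) : (c.above f U).Finite := by
  obtain ⟨x, hx, y, hy, hxy⟩ := hU
  obtain ⟨n, hn⟩ := c.exists_rank_bound hf (isOpen_compl_singleton (x := y)) (x := x) hxy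
  have hlevel : ∀ m, {z | x ∈ f '' c.W m z}.Finite := fun m => by
    refine ((c.locallyFinite m).finite_nonempty_inter_compact (hf.isCompact_fiber x)).subset ?_
    rintro w ⟨z, hz, hzx⟩
    exact ⟨z, hz, hzx⟩
  refine (((finite_Iio n).biUnion fun m _ => (hlevel m).image fun z => some (m, z)).insert
    none).subset ?_
  rintro (_ | ⟨m, z⟩) hi
  · exact mem_insert _ _
  · refine mem_insert_of_mem _ (mem_iUnion₂.2 ⟨m, ?_, z, hi hx, rfl⟩)
    by_contra hm
    exact hn (some (m, z)) (Nat.lt_succ_iff.2 (not_lt.1 hm)) (hi hx) (hi hy) rfl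

theorem exists_refinement (hf : IsOpenContinuousCompactSurjection f) (i : Option (ℕ × Z)) (x : X)
    (U : Set X) : ∃ j, IsOpen U → x ∈ U → i ∈ c.above f U →
      rank i < rank j ∧ x ∈ f '' c.sets j ∧ closure (c.sets j) ⊆ c.sets i ∩ f ⁻¹' U := by
  by_cases h : IsOpen U ∧ x ∈ U ∧ i ∈ c.above f U
  · obtain ⟨hU, hx, hi⟩ := h
    obtain ⟨z, hz, rfl⟩ := hi hx
    obtain ⟨j, hj, hzj, hjs⟩ := c.exists_closure_subset
      ((c.isOpen_sets i).inter (hU.preimage hf.continuous)) ⟨hz, hx⟩ (rank i)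
    exact ⟨j, fun _ _ _ => ⟨hj, ⟨z, hzj, rfl⟩, hjs⟩⟩
  -- `none` is a junk value, used when the move is illegal or `i` is not above `U`.
  · exact ⟨none, fun h1 h2 h3 => (h ⟨h1, h2, h3⟩).elim⟩

/-- A finer member of the family around a fiber. -/
noncomputable def finer (hf : IsOpenContinuousCompactSurjection f) (i : Option (ℕ × Z)) (x : X)
    (U : Set X) : Option (ℕ × Z) := (c.exists_refinement hf i x U).choose

theorem finer_spec (hf : IsOpenContinuousCompactSurjection f) {i : Option (ℕ × Z)} {x : X}
    {U : Set X} (hU : IsOpen U) (hx : x ∈ U) (hi : i ∈ c.above f U) :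
    rank i < rank (c.finer hf i x U) ∧ x ∈ f '' c.sets (c.finer hf i x U) ∧
      closure (c.sets (c.finer hf i x U)) ⊆ c.sets i ∩ f ⁻¹' U :=
  (c.exists_refinement hf i x U).choose_spec hU hx hi

open Classical in
/-- The answer of Nonempty to a move of Empty: refine all members of the family over the move. -/
noncomputable def answer (hf : IsOpenContinuousCompactSurjection f) (x : X) (U : Set X) : Set X :=
  if U.Nontrivial then U ∩ ⋂ i ∈ c.above f U, f '' c.sets (c.finer hf i x U) else U

theorem isOpen_answer [T1Space X] (hf : IsOpenContinuousCompactSurjection f) {x : X} {U : Set X}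
    (hU : IsOpen U) : IsOpen (c.answer hf x U) := by
  unfold answer
  split_ifs with h
  · exact hU.inter ((c.finite_above hf h).isOpen_biInter fun i _ =>
      hf.isOpenMap _ (c.isOpen_sets _))
  · exact hU

theorem mem_answer (hf : IsOpenContinuousCompactSurjection f) {x : X} {U : Set X}
    (hU : IsOpen U) (hx : x ∈ U) : x ∈ c.answer hf x U := by
  unfold answer
  split_ifs with h
  · exact ⟨hx, mem_iInter₂.2 fun i hi => (c.finer_spec hf hU hx hi).2.1⟩
  · exact hx

theorem answer_subset (hf : IsOpenContinuousCompactSurjection f) {x : X} {U : Set X} :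
    c.answer hf x U ⊆ U := by
  unfold answer
  split_ifs with h
  · exact inter_subset_left
  · exact subset_rfl

open ChoquetGame in
/-- The stationary strategy that answers each move by `GradedCover.answer`. -/
noncomputable def strategy [T1Space X] (hf : IsOpenContinuousCompactSurjection f) : Strategy X where
  respond p := p.getLast?.elim univ fun m => c.answer hf m.1 m.2
  isOpen_respond p x U h := by
    have := h p.length (by simp)
    simp only [List.getElem_concat_length] at this
    simpa using c.isOpen_answer hf this.1
  mem_respond p x U h := by
    have := h p.length (by simp)
    simp only [List.getElem_concat_length] at this
    simpa using c.mem_answer hf this.1 this.2.1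
  respond_subset p x U h := by simpa using c.answer_subset hf

theorem isStationary_strategy [T1Space X] (hf : IsOpenContinuousCompactSurjection f) :
    (c.strategy hf).IsStationary := by
  intro p x U _
  simp [strategy]

variable [T1Space X] (hf : IsOpenContinuousCompactSurjection f) {x : ℕ → X} {U V : ℕ → Set X}

theorem eq_answer (h : (c.strategy hf).IsPlay x U V) (n : ℕ) : V n = c.answer hf (x n) (U n) := by
  rw [h.follows n]
  simp [strategy, List.range_succ]

theorem antitone_play (h : (c.strategy hf).IsPlay x U V) : Antitone V :=
  antitone_nat_of_succ_le fun n => by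
    rw [c.eq_answer hf h (n + 1)]
    exact (c.answer_subset hf).trans (h.subset n)

/-- Once Empty plays a single point, that point is isolated and the play is constant from then on.
-/
theorem iInter_eq_of_subsingleton (h : (c.strategy hf).IsPlay x U V) {n : ℕ}
    (hn : ¬(U n).Nontrivial) : ⋂ k, V k = {x n} ∧ V n = {x n} := by
  have hUn : U n = {x n} :=
    (not_nontrivial_iff.1 hn).eq_singleton_of_mem (h.mem n)
  have hV : ∀ k, (V k).Nonempty := fun k => by
    rw [c.eq_answer hf h k]
    exact ⟨x k, c.mem_answer hf (h.isOpen k) (h.mem k)⟩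
  have hVn : V n ⊆ {x n} := by
    rw [c.eq_answer hf h n, ← hUn]
    exact c.answer_subset hf
  have hle : ∀ k, n ≤ k → V k = {x n} := fun k hk =>
    (subset_singleton_iff_eq.1 ((c.antitone_play hf h hk).trans hVn)).resolve_left (hV k).ne_empty
  refine ⟨subset_antisymm ((iInter_subset _ n).trans hVn) (subset_iInter fun k => ?_),
    hle n le_rfl⟩
  rw [← hle (max n k) (le_max_left _ _)]
  exact c.antitone_play hf h (le_max_right _ _)

/-- Starting from the whole space, refine along a play. -/
noncomputable def chain (x : ℕ → X) (U : ℕ → Set X) : ℕ → Option (ℕ × Z)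
  | 0 => none
  | n + 1 => c.finer hf (chain x U n) (x n) (U n)

/-- The answer refines every member above `U n`, in particular the current term of the chain, so the
next term is above `V n` and therefore above `U (n + 1)`. -/
theorem chain_mem_above (h : (c.strategy hf).IsPlay x U V) (hU : ∀ n, (U n).Nontrivial) :
    ∀ n, c.chain hf x U n ∈ c.above f (U n)
  | 0 => by
    change U 0 ⊆ f '' univ
    rw [image_univ, hf.surjective.range_eq]
    exact subset_univ _
  | n + 1 => by
    refine (h.subset n).trans ?_
    rw [c.eq_answer hf h n, answer, if_pos (hU n)]
    exact inter_subset_right.trans (iInter₂_subset (c.chain hf x U n) (chain_mem_above h hU n))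

theorem chain_spec (h : (c.strategy hf).IsPlay x U V) (hU : ∀ n, (U n).Nontrivial) (n : ℕ) :
    rank (c.chain hf x U n) < rank (c.chain hf x U (n + 1)) ∧
    x n ∈ f '' c.sets (c.chain hf x U (n + 1)) ∧
    closure (c.sets (c.chain hf x U (n + 1))) ⊆ c.sets (c.chain hf x U n) ∩ f ⁻¹' U n :=
  c.finer_spec hf (h.isOpen n) (h.mem n) (c.chain_mem_above hf h hU n)

theorem lt_rank_chain (h : (c.strategy hf).IsPlay x U V) (hU : ∀ n, (U n).Nontrivial) :
    ∀ n, n < rank (c.chain hf x U (n + 1))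
  | 0 => (Nat.zero_le _).trans_lt (c.chain_spec hf h hU 0).1
  | n + 1 => (Nat.succ_le_of_lt (lt_rank_chain h hU n)).trans_lt (c.chain_spec hf h hU (n + 1)).1

theorem isConvergent_strategy : (c.strategy hf).IsConvergent := by
  intro x U V h z hz
  by_cases hU : ∀ n, (U n).Nontrivial
  · refine ⟨fun O => ⟨fun hO => ?_, ?_⟩⟩
    · obtain ⟨O', hO'O, hO', hzO'⟩ := mem_nhds_iff.1 hO
      obtain ⟨n, hn⟩ := c.exists_rank_bound hf hO' hzO'
      have hV : V n ⊆ f '' c.sets (c.chain hf x U (n + 1)) := by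
        rw [c.eq_answer hf h n, answer, if_pos (hU n)]
        exact inter_subset_right.trans (iInter₂_subset _ (c.chain_mem_above hf h hU n))
      exact ⟨n, trivial, hV.trans <| (hn _ (c.lt_rank_chain hf h hU n)
        (hV (mem_iInter.1 hz n))).trans hO'O⟩
    · rintro ⟨n, -, hn⟩
      refine Filter.mem_of_superset (IsOpen.mem_nhds ?_ (mem_iInter.1 hz n)) hn
      rw [c.eq_answer hf h n]
      exact c.isOpen_answer hf (h.isOpen n)
  · push Not at hU
    obtain ⟨n, hn⟩ := hU
    obtain ⟨h1, h2⟩ := c.iInter_eq_of_subsingleton hf h (not_nontrivial_iff.2 hn)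
    rw [h1, mem_singleton_iff] at hz
    subst hz
    have hmem : ∀ k, x n ∈ V k := mem_iInter.1 (h1 ▸ mem_singleton (x n))
    refine ⟨fun O => ⟨fun hO => ⟨n, trivial, ?_⟩, ?_⟩⟩
    · rw [h2, singleton_subset_iff]
      exact mem_of_mem_nhds hO
    · rintro ⟨k, -, hk⟩
      refine Filter.mem_of_superset (IsOpen.mem_nhds ?_ (hmem k)) hk
      rw [c.eq_answer hf h k]
      exact c.isOpen_answer hf (h.isOpen k)

theorem isWinning_strategy [CompleteSpace Z] : (c.strategy hf).IsWinning := by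
  intro x U V h
  by_cases hU : ∀ n, (U n).Nontrivial
  · have hpt : ∀ n, ∃ z, z ∈ c.sets (c.chain hf x U (n + 1)) := fun n =>
      let ⟨z, hz, _⟩ := (c.chain_spec hf h hU n).2.1
      ⟨z, hz⟩
    choose z hz using hpt
    have hanti : Antitone fun n => c.sets (c.chain hf x U n) :=
      antitone_nat_of_succ_le fun n =>
        subset_closure.trans ((c.chain_spec hf h hU n).2.2.trans inter_subset_left)
    have hcauchy : CauchySeq z := by
      refine cauchySeq_of_le_tendsto_0 (fun n => 2 * (1 / 2 : ℝ) ^ n) (fun m k N hm hk => ?_) ?_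
      · exact c.dist_le (c.lt_rank_chain hf h hU N) (hanti (Nat.succ_le_succ hm) (hz m))
          (hanti (Nat.succ_le_succ hk) (hz k))
      · simpa using (tendsto_pow_atTop_nhds_zero_of_lt_one (r := (1 / 2 : ℝ)) (by norm_num)
          (by norm_num)).const_mul 2
    obtain ⟨w, hw⟩ := cauchySeq_tendsto_of_complete hcauchy
    -- The closure of term `n + 2` of the chain lies over `U (n + 1)`, which is contained in `V n`;
    -- hence the shift of index.
    refine ⟨f w, mem_iInter.2 fun n => h.subset n ?_⟩
    refine ((c.chain_spec hf h hU (n + 1)).2.2 (mem_closure_of_tendsto hw ?_)).2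
    exact Filter.eventually_atTop.2 ⟨n + 1, fun k hk => hanti (Nat.succ_le_succ hk) (hz k)⟩
  · push Not at hU
    obtain ⟨n, hn⟩ := hU
    rw [(c.iInter_eq_of_subsingleton hf h (not_nontrivial_iff.2 hn)).1]
    exact singleton_nonempty _

end GradedCover

end ImageOfMetricSpace

/-! ### Sieve trees and the positions of a strategy. -/

/-- A tree of open sets in which every branch starting from the root shrinks to a point at which its
members form a neighborhood basis, and in which the children of a node may be chosen freely among
the open sets that are small enough around a point. -/
structure SieveTree (X : Type u) [TopologicalSpace X] (N : Type v) where
  root : N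
  G : N → Set X
  Child : N → N → Prop
  G_root : G root = univ
  isOpen : ∀ t, IsOpen (G t)
  subset : ∀ {s t}, Child s t → G t ⊆ G s
  exists_child : ∀ t, ∀ x ∈ G t, ∃ O, IsOpen O ∧ x ∈ O ∧
    ∀ H, IsOpen H → H ⊆ O → ∃ t', Child t t' ∧ G t' = H
  branch : ∀ b : ℕ → N, b 0 = root → (∀ n, Child (b n) (b (n + 1))) →
    ∃ z, (∀ n, z ∈ G (b n)) ∧ (𝓝 z).HasBasis (fun _ : ℕ => True) fun n => G (b n)

namespace ChoquetGame

variable {X : Type u} [TopologicalSpace X]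

theorem IsPartialPlay.concat {S : List (X × Set X) → Set X} {p : List (X × Set X)}
    (hp : IsPartialPlay S p) {x : X} {U : Set X} (hU : IsOpen U) (hx : x ∈ U)
    (h : p ≠ [] → U ⊆ S p) : IsPartialPlay S (p ++ [(x, U)]) := by
  intro i hi
  rw [List.length_append, List.length_singleton, Nat.lt_succ_iff] at hi
  rcases hi.lt_or_eq with hi | rfl
  · rw [List.getElem_append_left hi, List.take_append_of_le_length hi.le]
    exact hp i hi
  · rw [List.getElem_concat_length rfl, List.take_left]
    exact ⟨hU, hx, fun h1 => h (List.ne_nil_of_length_pos h1)⟩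

namespace Strategy

variable (S : Strategy X)

/-- A partial play of Empty, with an open set that Empty may play next. -/
def Position : Type u :=
  {t : List (X × Set X) × Set X //
    IsPartialPlay S.respond t.1 ∧ IsOpen t.2 ∧ (t.1 ≠ [] → t.2 ⊆ S.respond t.1)}

variable {S}

/-- The positions after one more move of Empty. -/
def Position.Child (s t : S.Position) : Prop :=
  ∃ x ∈ s.1.2, t.1.1 = s.1.1 ++ [(x, s.1.2)]

theorem Position.isPartialPlay_concat (t : S.Position) {x : X} (hx : x ∈ t.1.2) :
    IsPartialPlay S.respond (t.1.1 ++ [(x, t.1.2)]) :=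
  t.2.1.concat t.2.2.1 hx t.2.2.2

/-- The tree of positions of a convergent and winning strategy. -/
def sieveTree (hc : S.IsConvergent) (hw : S.IsWinning) : SieveTree X S.Position where
  root := ⟨([], univ), fun i hi => absurd hi (Nat.not_lt_zero i), isOpen_univ,
    fun h => (h rfl).elim⟩
  G t := t.1.2
  Child := Position.Child
  G_root := rfl
  isOpen t := t.2.2.1
  subset := by
    rintro s t ⟨x, hx, ht⟩
    refine (t.2.2.2 (by simp [ht])).trans ?_
    rw [ht]
    exact S.respond_subset _ _ _ (s.isPartialPlay_concat hx)
  -- `H` may be empty: the resulting node has no children, since a child requires a point of its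
  -- parent, so it lies on no infinite branch.
  exists_child t x hx := by
    have h := t.isPartialPlay_concat hx
    exact ⟨S.respond (t.1.1 ++ [(x, t.1.2)]), S.isOpen_respond _ _ _ h, S.mem_respond _ _ _ h,
      fun H hH hHO => ⟨⟨(_, H), h, hH, fun _ => hHO⟩, ⟨x, hx, rfl⟩, rfl⟩⟩
  branch b hb0 hb := by
    choose x hx hbx using hb
    have hhist : ∀ n, (b n).1.1 = (List.range n).map fun i => (x i, (b i).1.2) := by
      intro n
      induction n with
      | zero => rw [hb0]; rfl
      | succ n ih => rw [hbx n, ih, List.range_succ, List.map_append]; rfl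
    have hsub : ∀ n, (b (n + 1)).1.2 ⊆ S.respond (b (n + 1)).1.1 := fun n =>
      (b (n + 1)).2.2.2 (by simp [hbx n])
    have hsub' : ∀ n, S.respond (b (n + 1)).1.1 ⊆ (b n).1.2 := fun n => by
      rw [hbx n]
      exact S.respond_subset _ _ _ ((b n).isPartialPlay_concat (hx n))
    have hplay : S.IsPlay x (fun n => (b n).1.2) fun n => S.respond (b (n + 1)).1.1 :=
      ⟨fun n => (b n).2.2.1, hx, hsub, fun n => by rw [hhist (n + 1)]⟩
    obtain ⟨z, hz⟩ := hw _ _ _ hplay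
    have hz' : ∀ n, z ∈ (b n).1.2 := fun n => hsub' n (mem_iInter.1 hz n)
    -- The answers of Nonempty interleave with the sets on the branch, so both sequences are bases
    -- at `z`.
    refine ⟨z, hz', (hc _ _ _ hplay z hz).to_hasBasis (fun n _ => ⟨n + 1, trivial, hsub n⟩)
      fun n _ => ⟨n, trivial, hsub' n⟩⟩

end Strategy

end ChoquetGame

/-! ### König's lemma and point-finite levels. -/

/-- König's lemma for the levels of a relation. -/
theorem exists_chain_of_finite_levels {N : Type v} (R : N → N → Prop) (A : ℕ → Set N)
    (hfin : ∀ n, (A n).Finite) (hne : ∀ n, (A n).Nonempty)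
    (hpar : ∀ n, ∀ t ∈ A (n + 1), ∃ s ∈ A n, R s t) :
    ∃ b : ℕ → N, ∀ n, b n ∈ A n ∧ R (b n) (b (n + 1)) := by
  -- `D k n` consists of the nodes in `A n` from which a chain runs through the next `k` levels.
  let D : ℕ → ℕ → Set N := fun k => Nat.rec A (fun _ E n => {s ∈ A n | ∃ t ∈ E (n + 1), R s t}) k
  have hDs : ∀ k n, D (k + 1) n = {s ∈ A n | ∃ t ∈ D k (n + 1), R s t} := fun _ _ => rfl
  have hDA : ∀ k n, D k n ⊆ A n := by
    rintro (_ | k) n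
    · exact subset_rfl
    · exact sep_subset _ _
  have hDne : ∀ k n, (D k n).Nonempty := by
    intro k
    induction k with
    | zero => exact hne
    | succ k ih =>
      intro n
      obtain ⟨t, ht⟩ := ih (n + 1)
      obtain ⟨s, hs, hst⟩ := hpar n t (hDA _ _ ht)
      exact ⟨s, hs, t, ht, hst⟩
  have hDanti : ∀ k n, D (k + 1) n ⊆ D k n := by
    intro k
    induction k with
    | zero => exact fun n => sep_subset _ _
    | succ k ih =>
      rintro n s ⟨hs, t, ht, hst⟩
      exact ⟨hs, t, ih _ ht, hst⟩
  -- The sets `D k n` decrease in `k` inside the finite set `A n`, so a property witnessed at every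
  -- stage has a witness common to all stages.
  have hfinInter : ∀ n (P : N → Prop), (∀ k, ∃ t ∈ D k n, P t) → ∃ t, (∀ k, t ∈ D k n) ∧ P t := by
    intro n P hP
    by_contra! hcon
    have hex : ∀ t, ∃ k, P t → t ∉ D k n := fun t => by
      by_contra! h
      exact hcon t (fun k => (h k).2) (h 0).1
    choose K hK using hex
    obtain ⟨M, hM⟩ := ((hfin n).image K).bddAbove
    obtain ⟨t, ht, hPt⟩ := hP M
    exact hK t hPt (antitone_nat_of_succ_le (f := fun k => D k n) (fun k => hDanti k n)
      (hM (mem_image_of_mem K (hDA _ _ ht))) ht)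
  let E : ℕ → Set N := fun n => {s | ∀ k, s ∈ D k n}
  have hEstep : ∀ n (s : E n), ∃ t : E (n + 1), R s t := by
    rintro n ⟨s, hs⟩
    obtain ⟨t, ht, hst⟩ := hfinInter (n + 1) (R s) fun k => (hs (k + 1)).2
    exact ⟨⟨t, ht⟩, hst⟩
  choose next hnext using hEstep
  obtain ⟨s₀, hs₀, -⟩ := hfinInter 0 (fun _ => True) fun k =>
    let ⟨t, ht⟩ := hDne k 0
    ⟨t, ht, trivial⟩
  let c : ∀ n, E n := fun n => Nat.rec ⟨s₀, hs₀⟩ (fun n s => next n s) n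
  exact ⟨fun n => (c n).1, fun n => ⟨(c n).2 0, hnext n (c n)⟩⟩

namespace SieveTree

variable {X : Type u} [TopologicalSpace X] {N : Type v} (T : SieveTree X N)

/-- A point-finite set of nodes covering the space, without empty members. -/
structure IsLevel (L : Set N) : Prop where
  finite : ∀ x, {t ∈ L | x ∈ T.G t}.Finite
  exists_mem : ∀ x, ∃ t ∈ L, x ∈ T.G t
  nonempty : ∀ t ∈ L, (T.G t).Nonempty

/-- Levels of the tree starting with the root, each of them made of children of the previous. -/
structure IsLevelSeq (L : ℕ → Set N) : Prop where
  zero : L 0 = {T.root}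
  isLevel : ∀ n, T.IsLevel (L n)
  exists_parent : ∀ n, ∀ t ∈ L (n + 1), ∃ s ∈ L n, T.Child s t

variable {T}

theorem isLevel_root [Nonempty X] : T.IsLevel {T.root} where
  finite x := (finite_singleton T.root).subset (sep_subset _ _)
  exists_mem x := ⟨T.root, rfl, T.G_root ▸ mem_univ x⟩
  nonempty := by
    rintro t rfl
    rw [T.G_root]
    exact univ_nonempty

theorem exists_levelSeq [Nonempty X] (P : Set N → Set N → Prop)
    (h : ∀ L, T.IsLevel L → ∃ L', T.IsLevel L' ∧ (∀ t ∈ L', ∃ s ∈ L, T.Child s t) ∧ P L L') :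
    ∃ L : ℕ → Set N, T.IsLevelSeq L ∧ ∀ n, P (L n) (L (n + 1)) := by
  choose next h1 h2 h3 using h
  let L : ℕ → {L // T.IsLevel L} := fun n =>
    Nat.rec ⟨{T.root}, isLevel_root⟩ (fun _ L => ⟨next L.1 L.2, h1 L.1 L.2⟩) n
  exact ⟨fun n => (L n).1, ⟨rfl, fun n => (L n).2, fun n => h2 (L n).1 (L n).2⟩,
    fun n => h3 (L n).1 (L n).2⟩

/-- Only finitely many nodes of `L` contain a given point, so one neighborhood `O x` is small enough
for all of them; a point-finite refinement of these neighborhoods supplies the new sets. The new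
level covers the space, but the children of one node need not cover that node; this weaker form is
what the F-sigma property is derived from. -/
theorem IsLevel.exists_next [Nonempty X] (hX : IsMetacompact X) {L : Set N} (hL : T.IsLevel L) :
    ∃ L', T.IsLevel L' ∧ ∀ t ∈ L', ∃ s ∈ L, T.Child s t := by
  have hO : ∀ x, ∃ O, IsOpen O ∧ x ∈ O ∧ ∀ s ∈ L, x ∈ T.G s →
      ∀ H, IsOpen H → H ⊆ O → ∃ t, T.Child s t ∧ T.G t = H := by
    intro x
    choose! O hOo hxO hO using fun s => T.exists_child s x
    refine ⟨⋂ s ∈ {s ∈ L | x ∈ T.G s}, O s, (hL.finite x).isOpen_biInter fun s hs => hOo s hs.2,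
      mem_iInter₂.2 fun s hs => hxO s hs.2, fun s hs hxs H hH hHO => ?_⟩
    exact hO s hxs H hH (hHO.trans (iInter₂_subset s ⟨hs, hxs⟩))
  choose O hOo hxO hO using hO
  obtain ⟨D, hDo, hDu, hDr, hDf⟩ := hX (range O) (by rintro _ ⟨x, rfl⟩; exact hOo x)
    (eq_univ_of_forall fun x => ⟨O x, ⟨x, rfl⟩, hxO x⟩)
  have hDr' : ∀ H ∈ D, ∃ x, H ⊆ O x := fun H hH => by
    obtain ⟨_, ⟨x, rfl⟩, hx⟩ := hDr H hH
    exact ⟨x, hx⟩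
  choose! pt hpt using hDr'
  choose! c hc hcG using fun s (H : Set X) (h : s ∈ L ∧ H ∈ D ∧ pt H ∈ T.G s) =>
    hO (pt H) s h.1 h.2.2 H (hDo H h.2.1) (hpt H h.2.1)
  refine ⟨{t | ∃ H ∈ D, ∃ s ∈ L, pt H ∈ T.G s ∧ H.Nonempty ∧ t = c s H}, ⟨fun x => ?_, fun x => ?_,
    ?_⟩, ?_⟩
  · refine ((hDf x).biUnion fun H _ => (hL.finite (pt H)).image fun s => c s H).subset ?_
    rintro _ ⟨⟨H, hH, s, hs, hsH, -, rfl⟩, hx⟩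
    rw [hcG s H ⟨hs, hH, hsH⟩] at hx
    exact mem_iUnion₂.2 ⟨H, ⟨hH, hx⟩, s, ⟨hs, hsH⟩, rfl⟩
  -- The parent is taken through `pt H`, not through `x`: it is at `pt H` that `H` is known to be
  -- small enough.
  · obtain ⟨H, hH, hx⟩ : x ∈ ⋃₀ D := hDu ▸ mem_univ x
    obtain ⟨s, hs, hsH⟩ := hL.exists_mem (pt H)
    refine ⟨c s H, ⟨H, hH, s, hs, hsH, ⟨x, hx⟩, rfl⟩, ?_⟩
    rwa [hcG s H ⟨hs, hH, hsH⟩]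
  · rintro _ ⟨H, hH, s, hs, hsH, hne, rfl⟩
    rwa [hcG s H ⟨hs, hH, hsH⟩]
  · rintro _ ⟨H, hH, s, hs, hsH, -, rfl⟩
    exact ⟨s, hs, hc s H ⟨hs, hH, hsH⟩⟩

/-- In a metacompact space with a sieve tree, open sets are countable increasing unions of closed
sets. -/
theorem exists_closed_iUnion_eq [T1Space X] (T : SieveTree X N) (hX : IsMetacompact X) {O : Set X}
    (hO : IsOpen O) : ∃ F : ℕ → Set X, (∀ n, IsClosed (F n)) ∧ Monotone F ∧ ⋃ n, F n = O := by
  rcases isEmpty_or_nonempty X with _ | _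
  · exact ⟨fun _ => ∅, fun _ => isClosed_empty, monotone_const, Subsingleton.elim _ _⟩
  obtain ⟨L, hL, -⟩ := exists_levelSeq (T := T) (fun _ _ => True) fun L hL =>
    let ⟨L', h1, h2⟩ := hL.exists_next hX
    ⟨L', h1, h2, trivial⟩
  -- `F n` removes all nodes of level `n` that stick out of `O`. A point of `O` removed at every
  -- level would, by König's lemma, lie on a branch of such nodes; the branch shrinks to that point,
  -- so one of its nodes is inside `O` after all.
  refine ⟨fun n => (⋃ t ∈ {t ∈ L n | ¬T.G t ⊆ O}, T.G t)ᶜ, fun n => ?_,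
    monotone_nat_of_le_succ fun n => ?_, subset_antisymm ?_ ?_⟩
  · exact (isOpen_biUnion fun t _ => T.isOpen t).isClosed_compl
  · refine compl_subset_compl.2 (iUnion₂_subset ?_)
    rintro t ⟨ht, htO⟩
    obtain ⟨s, hs, hst⟩ := hL.exists_parent n t ht
    exact (T.subset hst).trans (subset_iUnion₂_of_subset s
      ⟨hs, fun h => htO ((T.subset hst).trans h)⟩ subset_rfl)
  · refine iUnion_subset fun n y hy => ?_
    obtain ⟨t, ht, hyt⟩ := (hL.isLevel n).exists_mem y
    by_contra hyO
    exact hy (mem_iUnion₂.2 ⟨t, ⟨ht, fun h => hyO (h hyt)⟩, hyt⟩)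
  · intro y hy
    by_contra hcon
    have hcon' : ∀ n, ∃ t ∈ {t ∈ L n | ¬T.G t ⊆ O}, y ∈ T.G t := fun n => by
      by_contra h
      exact hcon (mem_iUnion.2 ⟨n, fun h' =>
        let ⟨t, ht, hyt⟩ := mem_iUnion₂.1 h'
        h ⟨t, ht, hyt⟩⟩)
    obtain ⟨b, hb⟩ := exists_chain_of_finite_levels T.Child
      (fun n => {t ∈ L n | y ∈ T.G t ∧ ¬T.G t ⊆ O})
      (fun n => ((hL.isLevel n).finite y).subset fun t ht => ⟨ht.1, ht.2.1⟩)
      (fun n => by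
        obtain ⟨t, ⟨ht, htO⟩, hyt⟩ := hcon' n
        exact ⟨t, ht, hyt, htO⟩)
      (fun n t ht => by
        obtain ⟨s, hs, hst⟩ := hL.exists_parent n t ht.1
        exact ⟨s, ⟨hs, T.subset hst ht.2.1, fun h => ht.2.2 ((T.subset hst).trans h)⟩, hst⟩)
    have hb0 : b 0 = T.root := by simpa [hL.zero] using (hb 0).1.1
    obtain ⟨z, hz, hbasis⟩ := T.branch b hb0 fun n => (hb n).2
    have hzy : z = y := by
      by_contra hne
      obtain ⟨n, -, hn⟩ := hbasis.mem_iff.1 (isOpen_compl_singleton.mem_nhds (x := z) hne)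
      exact hn (hb n).1.2.1 rfl
    obtain ⟨n, -, hn⟩ := hbasis.mem_iff.1 (hO.mem_nhds (hzy ▸ hy))
    exact (hb n).1.2.2 hn

end SieveTree

/-! ### Metacompactness of open sets and covering levels. -/

/-- In a metacompact space, a countable increasing union of closed sets that is open is metacompact. -/
theorem IsMetacompact.exists_refinement_of_iUnion_closed {X : Type u} [TopologicalSpace X]
    (hX : IsMetacompact X) {O : Set X} {F : ℕ → Set X} (hF : ∀ n, IsClosed (F n))
    (hmono : Monotone F) (hFO : ⋃ n, F n = O) {C : Set (Set X)} (hC : ∀ c ∈ C, IsOpen c)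
    (hCO : ⋃₀ C = O) : ∃ D : Set (Set X), (∀ d ∈ D, IsOpen d) ∧ ⋃₀ D = O ∧
      (∀ d ∈ D, ∃ c ∈ C, d ⊆ c) ∧ ∀ x : X, {d | d ∈ D ∧ x ∈ d}.Finite := by
  have h : ∀ n, ∃ D : Set (Set X), (∀ d ∈ D, IsOpen d) ∧ ⋃₀ D = univ ∧
      (∀ d ∈ D, ∃ c ∈ insert (F n)ᶜ C, d ⊆ c) ∧ ∀ x : X, {d | d ∈ D ∧ x ∈ d}.Finite := by
    refine fun n => hX _ ?_ ?_
    · rintro c (rfl | hc)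
      exacts [(hF n).isOpen_compl, hC c hc]
    · rw [sUnion_insert, hCO, ← compl_subset_iff_union, compl_compl, ← hFO]
      exact subset_iUnion F n
  choose D hDo hDu hDr hDf using h
  -- `E n` still covers `F n`, since the discarded members lie in its complement. Removing the
  -- previous closed set `F' n` leaves each point to the first `n` with the point in `F n`, and
  -- makes all members of later index miss it.
  let E : ℕ → Set (Set X) := fun n => {d ∈ D n | ∃ c ∈ C, d ⊆ c}
  let F' : ℕ → Set X := fun n => Nat.casesOn n ∅ F
  have hF' : ∀ n, IsClosed (F' n) := by
    rintro (_ | n)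
    exacts [isClosed_empty, hF n]
  have hsub : ∀ n, ∀ d ∈ E n, d ⊆ O := fun n d ⟨_, c, hc, hdc⟩ =>
    hdc.trans (hCO ▸ subset_sUnion_of_mem hc)
  refine ⟨{d | ∃ n, ∃ e ∈ E n, d = e \ F' n}, ?_, subset_antisymm (sUnion_subset ?_) ?_, ?_, ?_⟩
  · rintro _ ⟨n, e, he, rfl⟩
    exact (hDo n e he.1).sdiff (hF' n)
  · rintro _ ⟨n, e, he, rfl⟩
    exact sdiff_subset.trans (hsub n e he)
  · intro y hy
    classical
    have hex : ∃ n, y ∈ F n := by rwa [← hFO, mem_iUnion] at hy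
    obtain ⟨e, he, hye⟩ : y ∈ ⋃₀ D (Nat.find hex) := hDu _ ▸ mem_univ y
    have heE : e ∈ E (Nat.find hex) := by
      refine ⟨he, ?_⟩
      obtain ⟨c, rfl | hc, hec⟩ := hDr _ e he
      · exact (hec hye (Nat.find_spec hex)).elim
      · exact ⟨c, hc, hec⟩
    refine ⟨_, ⟨_, e, heE, rfl⟩, hye, ?_⟩
    rcases hn : Nat.find hex with _ | n
    · exact notMem_empty y
    · exact Nat.find_min hex (m := n) (by omega)
  · rintro _ ⟨n, e, ⟨he, c, hc, hec⟩, rfl⟩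
    exact ⟨c, hc, sdiff_subset.trans hec⟩
  · intro y
    by_cases hy : y ∈ O
    · obtain ⟨m, hm⟩ : ∃ n, y ∈ F n := by rwa [← hFO, mem_iUnion] at hy
      refine ((finite_Iic m).biUnion fun n _ => (hDf n y).image fun e => e \ F' n).subset ?_
      rintro _ ⟨⟨n, e, he, rfl⟩, hye, hyF⟩
      refine mem_iUnion₂.2 ⟨n, ?_, e, ⟨he.1, hye⟩, rfl⟩
      by_contra hn
      obtain ⟨k, rfl⟩ : ∃ k, n = k + 1 := ⟨n - 1, by simp at hn; omega⟩
      exact hyF (hmono (Nat.lt_succ_iff.1 (not_le.1 hn)) hm)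
    · refine finite_empty.subset ?_
      rintro _ ⟨⟨n, e, he, rfl⟩, hye, -⟩
      exact hy (hsub n e he hye)

namespace SieveTree

variable {X : Type u} [TopologicalSpace X] {N : Type v} {T : SieveTree X N}

/-- Each `T.G s` is open, hence F-sigma, hence metacompact, so it can be refined separately by sets
small enough to be children of `s`. Point-finiteness survives because only finitely many `s` in `L`
contain a given point. -/
theorem IsLevel.exists_covering_next [T1Space X] (hX : IsMetacompact X) {L : Set N}
    (hL : T.IsLevel L) : ∃ L', T.IsLevel L' ∧ (∀ t ∈ L', ∃ s ∈ L, T.Child s t) ∧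
      ∀ s ∈ L, ∀ x ∈ T.G s, ∃ t ∈ L', T.Child s t ∧ x ∈ T.G t := by
  have hD : ∀ s, ∃ D : Set (Set X), (∀ d ∈ D, IsOpen d) ∧ ⋃₀ D = T.G s ∧
      (∀ d ∈ D, ∃ t, T.Child s t ∧ T.G t = d) ∧ ∀ x : X, {d | d ∈ D ∧ x ∈ d}.Finite := by
    intro s
    obtain ⟨F, hF, hFm, hFu⟩ := T.exists_closed_iUnion_eq hX (T.isOpen s)
    obtain ⟨D, hDo, hDu, hDr, hDf⟩ := hX.exists_refinement_of_iUnion_closed hF hFm hFu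
      (C := {c | IsOpen c ∧ c ⊆ T.G s ∧ ∀ H, IsOpen H → H ⊆ c → ∃ t, T.Child s t ∧ T.G t = H})
      (fun c hc => hc.1) (subset_antisymm (sUnion_subset fun c hc => hc.2.1) fun x hx => by
        obtain ⟨O, hO, hxO, h⟩ := T.exists_child s x hx
        exact ⟨O ∩ T.G s, ⟨hO.inter (T.isOpen s), inter_subset_right,
          fun H hH hHO => h H hH (hHO.trans inter_subset_left)⟩, hxO, hx⟩)
    refine ⟨D, hDo, hDu, fun d hd => ?_, hDf⟩
    obtain ⟨c, hc, hdc⟩ := hDr d hd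
    exact hc.2.2 d (hDo d hd) hdc
  choose D hDo hDu hDc hDf using hD
  choose! c hc hcG using hDc
  refine ⟨{t | ∃ s ∈ L, ∃ d ∈ D s, d.Nonempty ∧ t = c s d}, ⟨fun x => ?_, fun x => ?_, ?_⟩, ?_, ?_⟩
  · refine ((hL.finite x).biUnion fun s _ => (hDf s x).image fun d => c s d).subset ?_
    rintro _ ⟨⟨s, hs, d, hd, -, rfl⟩, hx⟩
    rw [hcG s d hd] at hx
    exact mem_iUnion₂.2 ⟨s, ⟨hs, hDu s ▸ ⟨d, hd, hx⟩⟩, d, ⟨hd, hx⟩, rfl⟩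
  · obtain ⟨s, hs, hx⟩ := hL.exists_mem x
    obtain ⟨d, hd, hxd⟩ := (hDu s).symm ▸ hx
    exact ⟨c s d, ⟨s, hs, d, hd, ⟨x, hxd⟩, rfl⟩, (hcG s d hd).symm ▸ hxd⟩
  · rintro _ ⟨s, hs, d, hd, hne, rfl⟩
    rwa [hcG s d hd]
  · rintro _ ⟨s, hs, d, hd, -, rfl⟩
    exact ⟨s, hs, hc s d hd⟩
  · intro s hs x hx
    obtain ⟨d, hd, hxd⟩ := (hDu s).symm ▸ hx
    exact ⟨c s d, ⟨s, hs, d, hd, ⟨x, hxd⟩, rfl⟩, hc s d hd, (hcG s d hd).symm ▸ hxd⟩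

end SieveTree

/-! ### Weight. -/

section Weight

open Cardinal TopologicalSpace

theorem topWeight_le {X : Type u} [TopologicalSpace X] {B : Set (Set X)}
    (hB : IsTopologicalBasis B) : topWeight X ≤ #B :=
  csInf_le' ⟨B, hB, rfl⟩

theorem exists_basis_mk_eq_topWeight (X : Type u) [TopologicalSpace X] :
    ∃ B : Set (Set X), IsTopologicalBasis B ∧ #B = topWeight X :=
  csInf_mem (s := {c | ∃ B : Set (Set X), IsTopologicalBasis B ∧ #B = c})
    ⟨_, _, isTopologicalBasis_opens, rfl⟩

theorem aleph0_le_topWeight (X : Type u) [TopologicalSpace X] [T0Space X] [Infinite X] :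
    ℵ₀ ≤ topWeight X := by
  obtain ⟨B, hB, hBc⟩ := exists_basis_mk_eq_topWeight X
  rw [← hBc, aleph0_le_mk_iff]
  by_contra hfin
  rw [not_infinite_iff_finite] at hfin
  refine not_finite_iff_infinite.2 ‹Infinite X› (Finite.of_injective
    (fun x => {b : B | x ∈ (b : Set X)}) fun x y hxy => ?_)
  refine (hB.inseparable_iff.2 fun b hb => ?_).eq
  exact Set.ext_iff.1 hxy ⟨b, hb⟩

theorem IsOpenContinuousCompactSurjection.topWeight_le {Z X : Type u} [TopologicalSpace Z]
    [TopologicalSpace X] {f : Z → X} (hf : IsOpenContinuousCompactSurjection f) :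
    topWeight X ≤ topWeight Z := by
  obtain ⟨B, hB, hBc⟩ := exists_basis_mk_eq_topWeight Z
  rw [← hBc]
  have h := hB.isQuotientMap
    (hf.isOpenMap.isQuotientMap hf.continuous hf.surjective) hf.isOpenMap
  exact (_root_.topWeight_le h).trans mk_image_le

/-- Choose a point in each nonempty basic set. Every node is nonempty, so it contains a basic set
and its chosen point, while each chosen point lies in finitely many nodes. -/
theorem SieveTree.IsLevel.mk_le {X N : Type u} [TopologicalSpace X] [T0Space X] [Infinite X]
    {T : SieveTree X N} {L : Set N} (hL : T.IsLevel L) : #L ≤ topWeight X := by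
  obtain ⟨B, hB, hBc⟩ := exists_basis_mk_eq_topWeight X
  have hX := aleph0_le_topWeight X
  have hsub : L ⊆ ⋃ b : B, {t ∈ L | ∃ h : (b : Set X).Nonempty, h.some ∈ T.G t} := by
    intro t ht
    obtain ⟨x, hx⟩ := hL.nonempty t ht
    obtain ⟨b, hb, hxb, hbt⟩ := hB.exists_subset_of_mem_open hx (T.isOpen t)
    exact mem_iUnion.2 ⟨⟨b, hb⟩, ht, ⟨x, hxb⟩, hbt (Nonempty.some_mem _)⟩
  refine (mk_le_mk_of_subset hsub).trans ((mk_iUnion_le _).trans ?_)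
  rw [hBc]
  refine (mul_le_mul' le_rfl (ciSup_le' fun b => ?_)).trans (mul_aleph0_eq hX).le
  by_cases hb : (b : Set X).Nonempty
  · exact ((hL.finite hb.some).subset fun t ht => ⟨ht.1, ht.2.choose_spec⟩).lt_aleph0.le
  · have : {t ∈ L | ∃ h : (b : Set X).Nonempty, h.some ∈ T.G t} = ∅ :=
      eq_empty_of_forall_notMem fun t ht => hb ht.2.choose
    rw [this]
    simp

end Weight

/-! ### The space of branches and its limit map. -/

namespace SieveTree

variable {X : Type u} [TopologicalSpace X] {N : Type v} (T : SieveTree X N) (L : ℕ → Set N)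

/-- The branches of the tree that run through the levels `L`. -/
def branches : Set (ℕ → N) := {b | ∀ n, b n ∈ L n ∧ T.Child (b n) (b (n + 1))}

variable {T L}

theorem isClosed_branches [TopologicalSpace N] [DiscreteTopology N] :
    IsClosed (T.branches L) := by
  have h : T.branches L = ⋂ n, (fun b : ℕ → N => (b n, b (n + 1))) ⁻¹'
      {p | p.1 ∈ L n ∧ T.Child p.1 p.2} := by
    ext b
    simp [branches]
  rw [h]
  exact isClosed_iInter fun n => (isClosed_discrete _).preimage (by fun_prop)

theorem isOpen_setOf_apply_eq [TopologicalSpace N] [DiscreteTopology N] (n : ℕ) (t : N) :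
    IsOpen {b : T.branches L | b.1 n = t} :=
  (isOpen_discrete {t}).preimage (f := fun b : T.branches L => b.1 n)
    ((continuous_apply (A := fun _ => N) n).comp continuous_subtype_val)

theorem exists_limit (hL : T.IsLevelSeq L) (b : T.branches L) :
    ∃ z, (∀ n, z ∈ T.G (b.1 n)) ∧ (𝓝 z).HasBasis (fun _ : ℕ => True) fun n => T.G (b.1 n) :=
  T.branch b.1 (by simpa [hL.zero] using (b.2 0).1) fun n => (b.2 n).2

/-- The point to which a branch shrinks. -/
noncomputable def limit (hL : T.IsLevelSeq L) (b : T.branches L) : X := (exists_limit hL b).choose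

theorem limit_mem (hL : T.IsLevelSeq L) (b : T.branches L) (n : ℕ) :
    limit hL b ∈ T.G (b.1 n) := (exists_limit hL b).choose_spec.1 n

theorem hasBasis_nhds_limit (hL : T.IsLevelSeq L) (b : T.branches L) :
    (𝓝 (limit hL b)).HasBasis (fun _ : ℕ => True) fun n => T.G (b.1 n) :=
  (exists_limit hL b).choose_spec.2

theorem limit_eq_iff [T1Space X] (hL : T.IsLevelSeq L) {b : T.branches L} {y : X} :
    limit hL b = y ↔ ∀ n, y ∈ T.G (b.1 n) := by
  refine ⟨?_, fun h => ?_⟩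
  · rintro rfl
    exact limit_mem hL b
  · by_contra hne
    obtain ⟨n, -, hn⟩ := (hasBasis_nhds_limit hL b).mem_iff.1
      (isOpen_compl_singleton.mem_nhds (x := limit hL b) hne)
    exact hn (h n) rfl

/-- A branch through the levels with a given initial part and a given limit. -/
theorem exists_branch_extending [T1Space X] (hL : T.IsLevelSeq L)
    (hcov : ∀ n, ∀ s ∈ L n, ∀ x ∈ T.G s, ∃ t ∈ L (n + 1), T.Child s t ∧ x ∈ T.G t)
    (b : ℕ → N) (n : ℕ) (hb : ∀ k ≤ n, b k ∈ L k) (hb' : ∀ k < n, T.Child (b k) (b (k + 1)))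
    {y : X} (hy : y ∈ T.G (b n)) :
    ∃ c : T.branches L, (∀ k ≤ n, c.1 k = b k) ∧ limit hL c = y := by
  choose! next h1 h2 h3 using hcov
  -- Follow `b` up to index `n`, then keep choosing a child that contains `y`.
  let c : ℕ → N := fun k => Nat.rec (b 0) (fun k s => if k < n then b (k + 1) else next k s y) k
  have hcs : ∀ k, c (k + 1) = if k < n then b (k + 1) else next k (c k) y := fun _ => rfl
  have hcb : ∀ k ≤ n, c k = b k := by
    rintro (_ | k) hk
    · rfl
    · rw [hcs, if_pos (Nat.lt_of_succ_le hk)]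
  have hyb : ∀ k ≤ n, y ∈ T.G (b k) := fun k hk =>
    Nat.decreasingInduction' (P := fun k => y ∈ T.G (b k))
      (fun j hj _ h => T.subset (hb' j hj) h) hk hy
  have hc : ∀ k, c k ∈ L k ∧ y ∈ T.G (c k) := by
    intro k
    induction k with
    | zero => exact ⟨hb 0 (Nat.zero_le n), hyb 0 (Nat.zero_le n)⟩
    | succ k ih =>
      by_cases hk : k < n
      · rw [hcb _ hk]
        exact ⟨hb _ hk, hyb _ hk⟩
      · rw [hcs, if_neg hk]
        exact ⟨h1 k _ ih.1 y ih.2, h3 k _ ih.1 y ih.2⟩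
  refine ⟨⟨c, fun k => ⟨(hc k).1, ?_⟩⟩, hcb, (limit_eq_iff hL).2 fun k => (hc k).2⟩
  by_cases hk : k < n
  · rw [hcb _ hk, hcb _ hk.le]
    exact hb' k hk
  · rw [hcs, if_neg hk]
    exact h2 k _ (hc k).1 y (hc k).2

theorem isOpenContinuousCompactSurjection_limit [T1Space X] [TopologicalSpace N]
    [DiscreteTopology N] (hL : T.IsLevelSeq L)
    (hcov : ∀ n, ∀ s ∈ L n, ∀ x ∈ T.G s, ∃ t ∈ L (n + 1), T.Child s t ∧ x ∈ T.G t) :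
    IsOpenContinuousCompactSurjection (limit hL) where
  continuous := by
    refine continuous_iff_continuousAt.2 fun b => ?_
    refine (hasBasis_nhds_limit hL b).tendsto_right_iff.2 fun n _ => ?_
    filter_upwards [(isOpen_setOf_apply_eq n (b.1 n)).mem_nhds rfl] with c hc
    have := limit_mem hL c n
    rwa [show c.1 n = b.1 n from hc] at this
  isOpenMap := by
    refine IsOpenMap.of_nhds_le fun b => ?_
    intro A hA
    obtain ⟨A', hA', hAA'⟩ := mem_nhds_subtype _ _ _ |>.1 (Filter.mem_map.1 hA)
    obtain ⟨_, ⟨c, n, rfl⟩, hbc, hcA⟩ :=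
      (PiNat.isTopologicalBasis_cylinders fun _ => N).mem_nhds_iff.1 hA'
    -- The image of the cylinder of length `n` around `b` contains all of `T.G (b.1 n)`, as every
    -- point there is the limit of a branch extending `b`.
    refine Filter.mem_of_superset ((T.isOpen (b.1 n)).mem_nhds (limit_mem hL b n)) fun y hy => ?_
    obtain ⟨d, hd, rfl⟩ := exists_branch_extending hL hcov b.1 n (fun k _ => (b.2 k).1)
      (fun k _ => (b.2 k).2) hy
    refine hAA' (hcA ?_)
    rw [← PiNat.mem_cylinder_iff_eq.1 hbc]
    exact fun k hk => hd k hk.le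
  surjective y := by
    obtain ⟨t, ht, hy⟩ := (hL.isLevel 0).exists_mem y
    obtain ⟨c, -, hc⟩ := exists_branch_extending hL hcov (fun _ => t) 0
      (fun k hk => by rwa [Nat.le_zero.1 hk]) (fun k hk => absurd hk (Nat.not_lt_zero k)) hy
    exact ⟨c, hc⟩
  isCompact_fiber y := by
    -- The fiber is the trace of a product of finite sets on the closed set of branches.
    have h : limit hL ⁻¹' {y} =
        Subtype.val ⁻¹' (univ.pi fun n => {t ∈ L n | y ∈ T.G t}) := by
      ext b
      simp only [mem_preimage, mem_singleton_iff, limit_eq_iff, mem_univ_pi]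
      exact ⟨fun hb n => ⟨(b.2 n).1, hb n⟩, fun hb n => (hb n).2⟩
    rw [h]
    exact (isClosed_branches.isClosedEmbedding_subtypeVal).isCompact_preimage
      (isCompact_univ_pi fun n => ((hL.isLevel n).finite y).isCompact)

open Cardinal in
theorem topWeight_branches_le {X N : Type u} [TopologicalSpace X] {T : SieveTree X N}
    {L : ℕ → Set N} [TopologicalSpace N] [DiscreteTopology N] {κ : Cardinal.{u}} (hκ : ℵ₀ ≤ κ)
    (hLκ : ∀ n, #(L n) ≤ κ) : topWeight (T.branches L) ≤ κ := by
  -- Only nodes on the levels are counted; no bound on the cardinality of `N` itself is available.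
  let Y : Set N := ⋃ n, L n
  have hY : #Y ≤ κ := by
    have := (mk_iUnion_le_lift L).trans
      (mul_le_mul' le_rfl (ciSup_le' (a := κ) fun n => by simpa using hLκ n))
    simpa [aleph0_mul_eq hκ] using this
  let cyl : List Y → Set (T.branches L) := fun l =>
    ⋂ i : Fin l.length, {b | b.1 i = (l[i] : N)}
  have hB : TopologicalSpace.IsTopologicalBasis (range cyl) := by
    refine TopologicalSpace.isTopologicalBasis_of_isOpen_of_nhds ?_ fun b A hb hA => ?_
    · rintro _ ⟨l, rfl⟩
      exact isOpen_iInter_of_finite fun i => isOpen_setOf_apply_eq _ _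
    · obtain ⟨A', hA', rfl⟩ := isOpen_induced_iff.1 hA
      obtain ⟨_, ⟨c, n, rfl⟩, hbc, hcA⟩ :=
        (PiNat.isTopologicalBasis_cylinders fun _ => N).exists_subset_of_mem_open hb hA'
      refine ⟨_, ⟨(List.range n).map fun i => ⟨b.1 i, mem_iUnion.2 ⟨i, (b.2 i).1⟩⟩, rfl⟩, ?_, ?_⟩
      · exact mem_iInter.2 fun i => by simp
      · intro d hd
        refine hcA ?_
        rw [← PiNat.mem_cylinder_iff_eq.1 hbc]
        intro k hk
        simpa using mem_iInter.1 hd ⟨k, by simpa using hk⟩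
  calc topWeight (T.branches L) ≤ #(range cyl) := topWeight_le hB
    _ ≤ #(List Y) := mk_range_le
    _ ≤ max ℵ₀ #Y := mk_list_le_max _
    _ ≤ κ := max_le hκ hY

theorem exists_resolution {X N : Type u} [TopologicalSpace X] [T1Space X] [Infinite X]
    (T : SieveTree X N) (hX : IsMetacompact X) :
    ∃ (Z : Type u) (_ : MetricSpace Z) (_ : CompleteSpace Z) (f : Z → X),
      IsOpenContinuousCompactSurjection f ∧ topWeight Z = topWeight X := by
  obtain ⟨L, hL, hcov⟩ := exists_levelSeq (T := T)
    (fun L L' => ∀ s ∈ L, ∀ x ∈ T.G s, ∃ t ∈ L', T.Child s t ∧ x ∈ T.G t)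
    fun L hL => hL.exists_covering_next hX
  let _ : TopologicalSpace N := ⊥
  have : DiscreteTopology N := ⟨rfl⟩
  let _ : MetricSpace (ℕ → N) := PiNat.metricSpace
  have : CompleteSpace (ℕ → N) := PiNat.completeSpace
  have hf := isOpenContinuousCompactSurjection_limit hL hcov
  exact ⟨T.branches L, inferInstance, isClosed_branches.completeSpace_coe, limit hL, hf,
    (topWeight_branches_le (aleph0_le_topWeight X) fun n => (hL.isLevel n).mk_le).antisymm
      hf.topWeight_le⟩

end SieveTree

/-! ### The finite case and the theorem. -/

theorem exists_resolution_of_finite (X : Type u) [TopologicalSpace X] [T1Space X] [Finite X] :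
    ∃ (Z : Type u) (_ : MetricSpace Z) (_ : CompleteSpace Z) (f : Z → X),
      IsOpenContinuousCompactSurjection f ∧ topWeight Z = topWeight X := by
  let _ : MetricSpace X := TopologicalSpace.metrizableSpaceMetric X
  exact ⟨X, inferInstance, inferInstance, id, ⟨continuous_id, IsOpenMap.id, Function.surjective_id,
    fun x => (toFinite _).isCompact⟩, rfl⟩

theorem theoremT {X : Type u} [TopologicalSpace X] [T1Space X] :
    ((∃ (Z : Type u) (_ : MetricSpace Z) (_ : CompleteSpace Z) (f : Z → X),
        IsOpenContinuousCompactSurjection f) ↔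
      IsMetacompact X ∧
        ∃ S : ChoquetGame.Strategy X, S.IsConvergent ∧ S.IsWinning) ∧
    ((IsMetacompact X ∧
        ∃ S : ChoquetGame.Strategy X, S.IsConvergent ∧ S.IsWinning) →
      (∃ S : ChoquetGame.Strategy X, S.IsStationary ∧ S.IsConvergent ∧ S.IsWinning) ∧
      ∃ (Z : Type u) (_ : MetricSpace Z) (_ : CompleteSpace Z) (f : Z → X),
        IsOpenContinuousCompactSurjection f ∧ topWeight Z = topWeight X) := by
  have hab : (∃ (Z : Type u) (_ : MetricSpace Z) (_ : CompleteSpace Z) (f : Z → X),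
      IsOpenContinuousCompactSurjection f) → IsMetacompact X ∧
        ∃ S : ChoquetGame.Strategy X, S.IsStationary ∧ S.IsConvergent ∧ S.IsWinning := by
    rintro ⟨Z, _, _, f, hf⟩
    obtain ⟨c⟩ := GradedCover.nonempty (Z := Z)
    exact ⟨hf.isMetacompact, c.strategy hf, c.isStationary_strategy hf,
      c.isConvergent_strategy hf, c.isWinning_strategy hf⟩
  have hba : (IsMetacompact X ∧ ∃ S : ChoquetGame.Strategy X, S.IsConvergent ∧ S.IsWinning) →
      ∃ (Z : Type u) (_ : MetricSpace Z) (_ : CompleteSpace Z) (f : Z → X),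
        IsOpenContinuousCompactSurjection f ∧ topWeight Z = topWeight X := by
    rintro ⟨hX, S, hc, hw⟩
    -- The weight count needs an infinite cardinal; a finite T1 space is discrete and serves as its
    -- own `Z`.
    rcases finite_or_infinite X with _ | _
    · exact exists_resolution_of_finite X
    · exact (ChoquetGame.Strategy.sieveTree hc hw).exists_resolution hX
  refine ⟨⟨fun h => ?_, fun h => ?_⟩, fun h => ⟨?_, hba h⟩⟩
  · obtain ⟨hX, S, -, hS⟩ := hab h
    exact ⟨hX, S, hS⟩
  · obtain ⟨Z, i, j, f, hf, -⟩ := hba h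
    exact ⟨Z, i, j, f, hf⟩
  · obtain ⟨Z, i, j, f, hf, -⟩ := hba h
    exact (hab ⟨Z, i, j, f, hf⟩).2
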